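/- Let $G=(V,E)$ be a finite simple connected $d$-regular graph with $n$ vertices and $d\ge 2$. Let $A_G$ be its normalized adjacency matrix, $(A_G)_{ij}=\frac1d\mathbf 1_{\{i,j\}\in E}$, with eigenvalues $1=\lambda_1(A_G)\ge\lambda_2(A_G)\ge\dots\ge\lambda_n(A_G)$ counted with multiplicity. Put $\gamma(A_G)=(1-\lambda_2(A_G))^{-1}$, and let $d_G$ be the shortest-path metric on $V$. For $q\ge 1$ and $D\ge 1$, say that $(G,d_G)$ embeds into a real normed space $(X,\|\cdot\|_X)$ with $q$-average distortion at most $D$ if there are $\sigma\in(0,\infty)$ and a $\sigma D$-Lipschitz map $f:(V,d_G)\to X$ with $$\frac1{n^2}\sum_{u,v\in V}\|f(u)-f(v)\|_X^q\ \ge\ \frac{\sigma^q}{n^2}\sum_{u,v\in V}d_G(u,v)^q .$$ Theorem. For every $q\in[1,\infty)$ there exists $c(q)\in(0,\infty)$ such that for all $\gamma,D\in[1,\infty)$ and every $d\ge2$ the following holds. If $G$ is a $d$-regular connected graph on $n$ vertices with $\gamma(A_G)\le\gamma$, and $X$ is a real normed space such that $(G,d_G)$ embeds into $X$ with $q$-average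 distortion at most $D$, then $$\max\{\dim X,\,2\}\ \ge\ n^{\,c(q)/(\gamma D\log d)} .$$ In particular, $\dim X\ge n^{c(q)/(\gamma D\log d)}$ whenever $\dim X\ge 2$. -/

import Mathlib

open scoped ENNReal

noncomputable section

/-- The normalized adjacency matrix `A_G` of a `d`-regular graph `G`: its `(i, j)` entry is `1 / d`
if `{i, j}` is an edge and `0` otherwise. -/
def normalizedAdjMatrix {V : Type*} (G : SimpleGraph V) [DecidableRel G.Adj] (d : ℕ) :
    Matrix V V ℝ :=
  Matrix.of fun i j => if G.Adj i j then 1 / (d : ℝ) else 0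

theorem normalizedAdjMatrix_isHermitian {V : Type*} (G : SimpleGraph V) [DecidableRel G.Adj]
    (d : ℕ) : (normalizedAdjMatrix G d).IsHermitian := by
  ext i j
  simp [normalizedAdjMatrix, G.adj_comm]

/-- The second largest eigenvalue `λ₂(A)`, counted with multiplicity, of a real symmetric matrix
(`eigenvalues₀` lists the eigenvalues with multiplicity in decreasing order, starting from index
`0`). A matrix of size at most one has no second eigenvalue and gets the value `0`. -/
def secondEigenvalue {V : Type*} [Fintype V] [DecidableEq V] {A : Matrix V V ℝ}
    (hA : A.IsHermitian) : ℝ :=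
  if h : 1 < Fintype.card V then hA.eigenvalues₀ ⟨1, h⟩ else 0

/-- The reciprocal spectral gap `γ(A_G) = (1 - λ₂(A_G))⁻¹`, an element of `(0, ∞]`. -/
def reciprocalSpectralGap {V : Type*} [Fintype V] [DecidableEq V] (G : SimpleGraph V)
    [DecidableRel G.Adj] (d : ℕ) : ℝ≥0∞ :=
  (ENNReal.ofReal (1 - secondEigenvalue (normalizedAdjMatrix_isHermitian G d)))⁻¹

/-- The finite set `M` with the distance `dM` embeds into the metric space `N` with `q`-average
distortion at most `D`: for some scale `σ > 0` there is a `σ D`-Lipschitz map `f : M → N` such that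
the average of `dist (f x) (f y) ^ q` over `M × M` is at least `σ ^ q` times the average of
`dM x y ^ q`. As is usual for finite metric spaces, the averages are taken with respect to the
uniform probability measure on `M`. -/
def EmbedsWithAverageDistortion {M : Type*} [Fintype M] (dM : M → M → ℝ)
    (N : Type*) [PseudoMetricSpace N] (q D : ℝ) : Prop :=
  ∃ (σ : ℝ) (f : M → N), 0 < σ ∧
    (∀ x y, dist (f x) (f y) ≤ σ * D * dM x y) ∧
    σ ^ q * (1 / (Fintype.card M : ℝ) ^ 2 * ∑ x, ∑ y, dM x y ^ q) ≤
      1 / (Fintype.card M : ℝ) ^ 2 * ∑ x, ∑ y, dist (f x) (f y) ^ q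

end

/-! A Lipschitz map from a graph with a spectral gap into a low-dimensional space has a concentrated
image, whereas most pairs of vertices in a graph of degree `d` are far apart.

Concentration comes from the lazy walk `(1 + A) / 2`. On mean-zero scalar functions the gap makes
each step contract the squared `L₂` norm by `1 - 1 / (2γ)`. In an Auerbach basis this passes to
values in a `k`-dimensional space at the price of a factor `k ^ 2`, which `O(γ log K)` steps
overcome when `K ≥ max k 2`. One step displaces an `r`-Lipschitz function by at most `r` at each
vertex, so a mean-zero one has root mean square `O(γ r log K)` (`sum_norm_sq_le_of_gappedWalk`). The
dimension enters only through a logarithm.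

For larger `q`, the scalar Poincaré inequality applied to powers of the distance to the mean
repeatedly doubles the exponent, with constants depending only on `q` (`sum_pow_le_of_gappedWalk`).

Conversely, balls of radius `log n / (4 log d)` contain at most half of the vertices
(`SimpleGraph.card_filter_dist_lt_le`). Comparing the two averages gives `log n ≤ 512 C γ D log d
log K`. -/

/-! ### Auerbach bases -/

/-- **Auerbach's lemma**: a finite-dimensional real normed space has a basis of vectors of norm at
most one whose coordinate functionals have norm at most one. -/
theorem exists_auerbach_basis (X : Type*) [NormedAddCommGroup X] [NormedSpace ℝ X]
    [FiniteDimensional ℝ X] :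
    ∃ e : Module.Basis (Fin (Module.finrank ℝ X)) ℝ X,
      (∀ i, ‖e i‖ ≤ 1) ∧ ∀ x i, |e.repr x i| ≤ ‖x‖ := by
  classical
  set n := Module.finrank ℝ X
  let b : Module.Basis (Fin n) ℝ X := Module.finBasis ℝ X
  have : ProperSpace X := FiniteDimensional.proper_real X
  have hcont : Continuous fun v : Fin n → X => |b.det v| := by
    refine continuous_abs.comp ?_
    change Continuous fun v : Fin n → X => (b.toMatrix v).det
    refine Continuous.matrix_det ?_
    refine continuous_pi fun i => continuous_pi fun j => ?_
    exact ((b.coord i).continuous_of_finiteDimensional).comp (continuous_apply j)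
  -- The basis is a family in the unit ball of maximal determinant.
  obtain ⟨v, hv, hmax⟩ := (isCompact_closedBall (0 : Fin n → X) 1).exists_isMaxOn
    ⟨0, by simp⟩ hcont.continuousOn
  have hmem : ∀ w : Fin n → X, w ∈ Metric.closedBall 0 1 ↔ ∀ i, ‖w i‖ ≤ 1 := fun w => by
    rw [mem_closedBall_zero_iff, pi_norm_le_iff_of_nonneg zero_le_one]
  have hpos : 0 < |b.det v| := by
    have hb : ∀ i, ‖b i‖ ≠ 0 := fun i => norm_ne_zero_iff.2 (b.ne_zero i)
    have h1 : (fun i => ‖b i‖⁻¹ • b i) ∈ Metric.closedBall (0 : Fin n → X) 1 := by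
      rw [hmem]
      intro i
      rw [norm_smul, norm_inv, norm_norm, inv_mul_cancel₀ (hb i)]
    refine lt_of_lt_of_le ?_ (hmax h1)
    have h2 : b.det (fun i => ‖b i‖⁻¹ • b i) = ∏ i, ‖b i‖⁻¹ := by
      rw [AlternatingMap.map_smul_univ, b.det_self, smul_eq_mul, mul_one]
    simp only [h2, abs_pos]
    exact Finset.prod_ne_zero_iff.2 fun i _ => inv_ne_zero (hb i)
  have hbasis := (b.is_basis_iff_det (v := v)).2 (isUnit_iff_ne_zero.2 (abs_pos.1 hpos))
  let e : Module.Basis (Fin n) ℝ X := Module.Basis.mk hbasis.1 hbasis.2.ge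
  have he : ⇑e = v := Module.Basis.coe_mk _ _
  -- Cramer's rule: a coordinate is a ratio of determinants, which maximality bounds by one.
  have hcoord : ∀ x i, b.det (Function.update v i x) = e.repr x i * b.det v := by
    intro x i
    conv_lhs => rw [← e.sum_repr x]
    rw [AlternatingMap.map_update_sum, Finset.sum_eq_single i]
    · rw [AlternatingMap.map_update_smul, he, Function.update_eq_self, smul_eq_mul]
    · intro j _ hj
      rw [AlternatingMap.map_update_smul, he, AlternatingMap.map_update_self _ _ hj.symm, smul_zero]
    · simp
  have hunit : ∀ x i, ‖x‖ ≤ 1 → |e.repr x i| ≤ 1 := by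
    intro x i hx
    have h1 : Function.update v i x ∈ Metric.closedBall (0 : Fin n → X) 1 := by
      rw [hmem]
      intro j
      rcases eq_or_ne j i with rfl | hj
      · simpa using hx
      · simpa [hj] using (hmem v).1 hv j
    have h2 : |b.det (Function.update v i x)| ≤ |b.det v| := hmax h1
    rw [hcoord, abs_mul] at h2
    exact le_of_mul_le_mul_right (by simpa using h2) hpos
  refine ⟨e, fun i => he ▸ (hmem v).1 hv i, fun x i => ?_⟩
  rcases eq_or_ne x 0 with rfl | hx
  · simp
  have h0 : 0 < ‖x‖ := norm_pos_iff.2 hx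
  have h1 := hunit (‖x‖⁻¹ • x) i (by rw [norm_smul, norm_inv, norm_norm, inv_mul_cancel₀ h0.ne'])
  rw [map_smul, Finsupp.smul_apply, smul_eq_mul, abs_mul, abs_inv, abs_norm,
    inv_mul_le_iff₀ h0] at h1
  simpa using h1

/-! ### Spectral gap on mean-zero functions -/

/-- Since `λ₂ < 1`, every eigenvector but the top one has eigenvalue below one, hence is orthogonal
to the fixed vector `1`. So `1` spans the top eigenline, and a mean-zero `g` has no component along
it. -/
theorem dotProduct_mulVec_le_secondEigenvalue {V : Type*} [Fintype V] [DecidableEq V]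
    {A : Matrix V V ℝ} (hA : A.IsHermitian) (hcard : 1 < Fintype.card V)
    (hlt : secondEigenvalue hA < 1) (h1 : A.mulVec 1 = 1) {g : V → ℝ} (hg : ∑ u, g u = 0) :
    ∑ u, g u * A.mulVec g u ≤ secondEigenvalue hA * ∑ u, g u ^ 2 := by
  set l := secondEigenvalue hA with hl
  let e : V → V → ℝ := fun i u => hA.eigenvectorBasis i u
  have hpars : ∀ x y : V → ℝ,
      ∑ i, (∑ u, e i u * x u) * (∑ u, e i u * y u) = ∑ u, x u * y u := by
    intro x y
    have := hA.eigenvectorBasis.sum_inner_mul_inner (WithLp.toLp 2 x) (WithLp.toLp 2 y)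
    simpa [PiLp.inner_apply, e, mul_comm] using this
  have hsymm : ∀ i (x : V → ℝ),
      ∑ u, e i u * A.mulVec x u = hA.eigenvalues i * ∑ u, e i u * x u := by
    intro i x
    have h2 : A.mulVec (e i) = hA.eigenvalues i • e i := hA.mulVec_eigenvectorBasis i
    have hT : A.transpose = A := by simpa using hA.eq
    have h3 : e i ⬝ᵥ A.mulVec x = A.mulVec (e i) ⬝ᵥ x := by
      rw [Matrix.dotProduct_mulVec, ← Matrix.mulVec_transpose, hT]
    rw [h2, smul_dotProduct] at h3
    simpa [dotProduct] using h3
  let φ : V ≃ Fin (Fintype.card V) := (Fintype.equivOfCardEq (Fintype.card_fin _)).symm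
  have hev : ∀ i, hA.eigenvalues i = hA.eigenvalues₀ (φ i) := fun i => rfl
  let i₀ : V := φ.symm ⟨0, by omega⟩
  have hle : ∀ i, i ≠ i₀ → hA.eigenvalues i ≤ l := by
    intro i hi
    rw [hev, hl, secondEigenvalue, dif_pos hcard]
    refine hA.eigenvalues₀_antitone (Fin.mk_le_of_le_val ?_)
    by_contra hcon
    apply hi
    rw [Equiv.eq_symm_apply]
    exact Fin.ext (by simp only at hcon ⊢; omega)
  have hone : ∀ i, i ≠ i₀ → ∑ u, e i u * (1 : V → ℝ) u = 0 := by
    intro i hi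
    have h2 := hsymm i 1
    rw [h1] at h2
    have h3 := hle i hi
    have h4 : (1 - hA.eigenvalues i) * ∑ u, e i u * (1 : V → ℝ) u = 0 := by linarith
    rcases mul_eq_zero.1 h4 with h | h
    · linarith
    · exact h
  have hc0 : ∑ u, e i₀ u * g u = 0 := by
    have h2 := hpars g 1
    rw [Finset.sum_eq_single i₀ (fun i _ hi => by rw [hone i hi, mul_zero]) (by simp)] at h2
    have h3 := hpars 1 1
    rw [Finset.sum_eq_single i₀ (fun i _ hi => by rw [hone i hi, mul_zero]) (by simp)] at h3
    have h4 : ∑ u, g u * (1 : V → ℝ) u = 0 := by simpa using hg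
    rw [h4] at h2
    refine (mul_eq_zero.1 h2).resolve_right fun h => ?_
    rw [h] at h3
    simp only [Pi.one_apply, mul_one, Finset.sum_const, Finset.card_univ, nsmul_eq_mul] at h3
    have : (0 : ℝ) < Fintype.card V := by exact_mod_cast (by omega)
    linarith
  have hsq : ∑ u, g u ^ 2 = ∑ i, (∑ u, e i u * g u) ^ 2 := by
    simp only [pow_two, hpars]
  rw [← hpars g, hsq, Finset.mul_sum]
  refine Finset.sum_le_sum fun i _ => ?_
  rw [hsymm]
  rcases eq_or_ne i i₀ with rfl | hi
  · simp [hc0]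
  · nlinarith [mul_le_mul_of_nonneg_right (hle i hi) (sq_nonneg (∑ u, e i u * g u))]

/-! ### Growth of balls -/

/-- Balls of radius `r` in a graph of maximal degree `d ≥ 2` have at most `2 d ^ r` vertices. -/
theorem SimpleGraph.card_filter_dist_le {V : Type*} [Fintype V] [DecidableEq V]
    (G : SimpleGraph V) [DecidableRel G.Adj] {d : ℕ} (hd : 2 ≤ d) (hdeg : ∀ v, G.degree v ≤ d)
    (hG : G.Connected) (u : V) (r : ℕ) :
    (Finset.univ.filter fun v => G.dist u v ≤ r).card + 1 ≤ 2 * d ^ r := by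
  induction r with
  | zero =>
    have : (Finset.univ.filter fun v => G.dist u v ≤ 0) = {u} := by
      ext v
      simp [hG.dist_eq_zero_iff, eq_comm]
    rw [this]; simp
  | succ r ih =>
    have hsub : (Finset.univ.filter fun v => G.dist u v ≤ r + 1) ⊆
        {u} ∪ (Finset.univ.filter fun v => G.dist u v ≤ r).biUnion fun w => G.neighborFinset w := by
      intro v hv
      simp only [Finset.mem_filter, Finset.mem_univ, true_and, Finset.mem_union,
        Finset.mem_singleton, Finset.mem_biUnion, SimpleGraph.mem_neighborFinset] at hv ⊢
      rcases eq_or_ne v u with h | h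
      · exact Or.inl h
      right
      obtain ⟨p, hp⟩ := hG.exists_walk_length_eq_dist v u
      cases p with
      | nil => exact absurd rfl h
      | cons hadj p =>
        rename_i w
        refine ⟨w, ?_, hadj.symm⟩
        have h1 := SimpleGraph.dist_le p
        rw [SimpleGraph.Walk.length_cons, SimpleGraph.dist_comm] at hp
        rw [SimpleGraph.dist_comm] at h1
        omega
    have h1 := Finset.card_le_card hsub
    have h2 : ((Finset.univ.filter fun v => G.dist u v ≤ r).biUnion fun w => G.neighborFinset w).card ≤
        (Finset.univ.filter fun v => G.dist u v ≤ r).card * d :=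
      Finset.card_biUnion_le_card_mul _ _ _ fun v _ => hdeg v
    have h3 := Finset.card_union_le {u}
      ((Finset.univ.filter fun v => G.dist u v ≤ r).biUnion fun w => G.neighborFinset w)
    rw [Finset.card_singleton] at h3
    -- The `+ 1` closes the induction: `(1 + d b) + 1 ≤ d (b + 1)` because `d ≥ 2`.
    have h4 : ((Finset.univ.filter fun v => G.dist u v ≤ r).card + 1) * d ≤ 2 * d ^ r * d :=
      Nat.mul_le_mul_right d ih
    rw [pow_succ]
    nlinarith

/-! ### Scalar functions on a gapped walk -/

/-- `A` is a symmetric stochastic matrix whose quadratic form on mean-zero functions is at most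
`1 - 1 / γ` times the squared norm. -/
structure IsGappedWalk {V : Type*} [Fintype V] (A : Matrix V V ℝ) (γ : ℝ) : Prop where
  nonneg : ∀ u v, 0 ≤ A u v
  symm : ∀ u v, A u v = A v u
  row_sum : ∀ u, ∑ v, A u v = 1
  one_le : 1 ≤ γ
  gap : ∀ g : V → ℝ, ∑ u, g u = 0 →
    ∑ u, g u * ∑ v, A u v * g v ≤ (1 - 1 / γ) * ∑ u, g u ^ 2

/-- One step of the lazy random walk of `A`, acting on vector-valued functions. -/
noncomputable def lazyStep {V X : Type*} [Fintype V] [AddCommGroup X] [Module ℝ X]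
    (A : Matrix V V ℝ) (g : V → X) (u : V) : X :=
  (1 / 2 : ℝ) • (g u + ∑ v, A u v • g v)

namespace IsGappedWalk

variable {V : Type*} [Fintype V] {A : Matrix V V ℝ} {γ : ℝ}

theorem col_sum (h : IsGappedWalk A γ) (v : V) : ∑ u, A u v = 1 := by
  simp only [h.symm _ v, h.row_sum]

theorem sum_sum_mul_left (h : IsGappedWalk A γ) (g : V → ℝ) :
    ∑ u, ∑ v, A u v * g u = ∑ u, g u := by
  simp only [← Finset.sum_mul, h.row_sum, one_mul]

theorem sum_sum_mul_right (h : IsGappedWalk A γ) (g : V → ℝ) :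
    ∑ u, ∑ v, A u v * g v = ∑ u, g u := by
  rw [Finset.sum_comm]
  simp only [← Finset.sum_mul, h.col_sum, one_mul]

/-- Cauchy–Schwarz in each row, then the columns sum to one. -/
theorem sum_sq_walk_le (h : IsGappedWalk A γ) (g : V → ℝ) :
    ∑ u, (∑ v, A u v * g v) ^ 2 ≤ ∑ u, g u ^ 2 := by
  rw [← h.sum_sum_mul_right fun v => g v ^ 2]
  refine Finset.sum_le_sum fun u _ => ?_
  have := Finset.sum_sq_le_sum_mul_sum_of_sq_le_mul (R := ℝ) Finset.univ (r := fun v => A u v * g v)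
    (f := fun v => A u v) (g := fun v => A u v * g v ^ 2) (fun v _ => h.nonneg u v)
    (fun v _ => mul_nonneg (h.nonneg u v) (sq_nonneg _)) (fun v _ => le_of_eq (by ring))
  rwa [h.row_sum, one_mul] at this

theorem sum_lazyStep (h : IsGappedWalk A γ) (g : V → ℝ) :
    ∑ u, lazyStep A g u = ∑ u, g u := by
  simp only [lazyStep, smul_eq_mul, ← Finset.mul_sum, Finset.sum_add_distrib, h.sum_sum_mul_right]
  ring

/-- Expanding the square of `(g + A g) / 2`, only the cross term needs the gap. Laziness makes a
lower bound on the spectrum of `A` unnecessary. -/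
theorem sum_sq_lazyStep_le (h : IsGappedWalk A γ) {g : V → ℝ} (hg : ∑ u, g u = 0) :
    ∑ u, lazyStep A g u ^ 2 ≤ (1 - 1 / (2 * γ)) * ∑ u, g u ^ 2 := by
  have h1 := h.gap g hg
  have h2 := h.sum_sq_walk_le g
  have h3 : ∑ u, lazyStep A g u ^ 2 = 1 / 4 * ∑ u, g u ^ 2 +
      1 / 2 * ∑ u, g u * ∑ v, A u v * g v + 1 / 4 * ∑ u, (∑ v, A u v * g v) ^ 2 := by
    simp only [Finset.mul_sum, ← Finset.sum_add_distrib]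
    refine Finset.sum_congr rfl fun u _ => ?_
    simp only [lazyStep, smul_eq_mul, ← Finset.mul_sum]
    ring
  have h4 : 1 / (2 * γ) = 1 / 2 * (1 / γ) := by
    rw [one_div_mul_one_div]
  rw [h3, h4]
  linarith

theorem sum_sq_lazyStep_iterate_le (h : IsGappedWalk A γ) {g : V → ℝ} (hg : ∑ u, g u = 0) (t : ℕ) :
    ∑ u, ((lazyStep A)^[t] g) u ^ 2 ≤ (1 - 1 / (2 * γ)) ^ t * ∑ u, g u ^ 2 := by
  have hρ : 0 ≤ 1 - 1 / (2 * γ) := by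
    have := h.one_le
    rw [sub_nonneg, div_le_one (by linarith)]
    linarith
  have key : ∑ u, ((lazyStep A)^[t] g) u = 0 ∧
      ∑ u, ((lazyStep A)^[t] g) u ^ 2 ≤ (1 - 1 / (2 * γ)) ^ t * ∑ u, g u ^ 2 := by
    induction t with
    | zero => simp [hg]
    | succ t ih =>
      rw [Function.iterate_succ_apply']
      refine ⟨by rw [h.sum_lazyStep, ih.1], (h.sum_sq_lazyStep_le ih.1).trans ?_⟩
      rw [pow_succ', mul_assoc]
      exact mul_le_mul_of_nonneg_left ih.2 hρ
  exact key.2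

/-- The Dirichlet form is `2⟨g - m, (1 - A)(g - m)⟩` with `m` the mean of `g`, so the gap bounds the
variance. -/
theorem poincare (h : IsGappedWalk A γ) [Nonempty V] (g : V → ℝ) :
    ∑ u, g u ^ 2 ≤ (∑ u, g u) ^ 2 / Fintype.card V +
      γ / 2 * ∑ u, ∑ v, A u v * (g u - g v) ^ 2 := by
  have hn : (0 : ℝ) < Fintype.card V := by exact_mod_cast Fintype.card_pos
  have hγ : 0 < γ := lt_of_lt_of_le one_pos h.one_le
  set m := (∑ u, g u) / Fintype.card V with hm
  have hnm : ∑ u, g u = Fintype.card V * m := by rw [hm]; field_simp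
  have hmean : ∑ u, (g u - m) = 0 := by
    rw [Finset.sum_sub_distrib, hnm]; simp
  have h1 := h.gap (fun u => g u - m) hmean
  have h2 : ∑ u, ∑ v, A u v * (g u - g v) ^ 2 =
      2 * ∑ u, (g u - m) ^ 2 - 2 * ∑ u, (g u - m) * ∑ v, A u v * (g v - m) := by
    have e : ∀ u v, A u v * (g u - g v) ^ 2 = A u v * (g u - m) ^ 2 + A u v * (g v - m) ^ 2 -
        2 * ((g u - m) * (A u v * (g v - m))) := fun u v => by ring
    simp only [e, Finset.sum_sub_distrib, Finset.sum_add_distrib, ← Finset.mul_sum]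
    rw [h.sum_sum_mul_left fun u => (g u - m) ^ 2, h.sum_sum_mul_right fun u => (g u - m) ^ 2]
    ring
  have h3 : ∑ u, (g u - m) ^ 2 = ∑ u, g u ^ 2 - (∑ u, g u) ^ 2 / Fintype.card V := by
    have e : ∀ u, (g u - m) ^ 2 = g u ^ 2 - 2 * m * g u + m ^ 2 := fun u => by ring
    simp only [e, Finset.sum_sub_distrib, Finset.sum_add_distrib, ← Finset.mul_sum, hnm]
    simp only [Finset.sum_const, Finset.card_univ, nsmul_eq_mul]
    field_simp
    ring
  have h4 : ∑ u, (g u - m) ^ 2 ≤ γ / 2 * ∑ u, ∑ v, A u v * (g u - g v) ^ 2 := by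
    rw [h2]
    have h5 : γ * (1 / γ) = 1 := by field_simp
    have h6 := mul_le_mul_of_nonneg_left h1 hγ.le
    linear_combination h6 - (∑ u, (g u - m) ^ 2) * h5
  linarith

end IsGappedWalk

/-! ### Vector-valued functions under the lazy walk -/

section lazyStep

variable {V X : Type*} [Fintype V] {A : Matrix V V ℝ} {γ : ℝ}

theorem lazyStep_map [AddCommGroup X] [Module ℝ X] (φ : X →ₗ[ℝ] ℝ) (g : V → X) :
    lazyStep A (fun u => φ (g u)) = fun u => φ (lazyStep A g u) := by
  funext u
  simp only [lazyStep, map_smul, map_add, map_sum]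

theorem lazyStep_iterate_map [AddCommGroup X] [Module ℝ X] (φ : X →ₗ[ℝ] ℝ) (g : V → X) (t : ℕ) :
    (lazyStep A)^[t] (fun u => φ (g u)) = fun u => φ ((lazyStep A)^[t] g u) := by
  induction t with
  | zero => rfl
  | succ t ih => rw [Function.iterate_succ_apply', ih, lazyStep_map, Function.iterate_succ_apply']

variable [NormedAddCommGroup X] [NormedSpace ℝ X]

theorem norm_lazyStep_sub_le (h : IsGappedWalk A γ) {f g : V → X} {r : ℝ}
    (hfg : ∀ u, ‖f u - g u‖ ≤ r) (u : V) : ‖lazyStep A f u - lazyStep A g u‖ ≤ r := by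
  have e : lazyStep A f u - lazyStep A g u =
      (1 / 2 : ℝ) • ((f u - g u) + ∑ v, A u v • (f v - g v)) := by
    simp only [lazyStep, smul_sub, Finset.sum_sub_distrib, smul_add]
    abel
  have h1 : ‖∑ v, A u v • (f v - g v)‖ ≤ r := by
    calc ‖∑ v, A u v • (f v - g v)‖ ≤ ∑ v, A u v * r := by
          refine norm_sum_le_of_le _ fun v _ => ?_
          rw [norm_smul, Real.norm_of_nonneg (h.nonneg u v)]
          exact mul_le_mul_of_nonneg_left (hfg v) (h.nonneg u v)
      _ = r := by rw [← Finset.sum_mul, h.row_sum, one_mul]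
  rw [e, norm_smul, Real.norm_of_nonneg (by norm_num)]
  linarith [norm_add_le (f u - g u) (∑ v, A u v • (f v - g v)), hfg u]

theorem norm_sub_lazyStep_le (h : IsGappedWalk A γ) {f : V → X} {r : ℝ} (hr : 0 ≤ r)
    (hf : ∀ u v, A u v ≠ 0 → ‖f u - f v‖ ≤ r) (u : V) : ‖f u - lazyStep A f u‖ ≤ r := by
  have e : f u - lazyStep A f u = (1 / 2 : ℝ) • ∑ v, A u v • (f u - f v) := by
    simp only [lazyStep, smul_sub, Finset.sum_sub_distrib, smul_add, ← Finset.sum_smul, h.row_sum,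
      one_smul]
    module
  have h1 : ‖∑ v, A u v • (f u - f v)‖ ≤ r := by
    calc ‖∑ v, A u v • (f u - f v)‖ ≤ ∑ v, A u v * r := by
          refine norm_sum_le_of_le _ fun v _ => ?_
          rw [norm_smul, Real.norm_of_nonneg (h.nonneg u v)]
          rcases eq_or_ne (A u v) 0 with h0 | h0
          · simp [h0]
          · exact mul_le_mul_of_nonneg_left (hf u v h0) (h.nonneg u v)
      _ = r := by rw [← Finset.sum_mul, h.row_sum, one_mul]
  rw [e, norm_smul, Real.norm_of_nonneg (by norm_num)]
  linarith

theorem norm_sub_lazyStep_iterate_le (h : IsGappedWalk A γ) {f : V → X} {r : ℝ} (hr : 0 ≤ r)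
    (hf : ∀ u v, A u v ≠ 0 → ‖f u - f v‖ ≤ r) (t : ℕ) (u : V) :
    ‖f u - (lazyStep A)^[t] f u‖ ≤ t * r := by
  induction t generalizing u with
  | zero => simp
  | succ t ih =>
    rw [Function.iterate_succ_apply']
    have h1 := norm_lazyStep_sub_le h ih u
    have h2 := norm_sub_lazyStep_le h hr hf u
    have h3 := norm_sub_le_norm_sub_add_norm_sub (f u) (lazyStep A f u)
      (lazyStep A ((lazyStep A)^[t] f) u)
    push_cast
    linarith

/-- A mean-zero function with values in a `k`-dimensional space contracts exponentially fast in
`L₂` under the lazy walk, up to a factor `k ^ 2`. -/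
theorem sum_norm_sq_lazyStep_iterate_le [FiniteDimensional ℝ X] (h : IsGappedWalk A γ) {g : V → X}
    (hg : ∑ u, g u = 0) (t : ℕ) :
    ∑ u, ‖(lazyStep A)^[t] g u‖ ^ 2 ≤
      (Module.finrank ℝ X : ℝ) ^ 2 * (1 - 1 / (2 * γ)) ^ t * ∑ u, ‖g u‖ ^ 2 := by
  have hX := exists_auerbach_basis X
  generalize Module.finrank ℝ X = k at hX ⊢
  obtain ⟨e, he, hrepr⟩ := hX
  have hρ : 0 ≤ 1 - 1 / (2 * γ) := by
    have := h.one_le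
    rw [sub_nonneg, div_le_one (by linarith)]
    linarith
  have hup : ∀ x : X, ‖x‖ ^ 2 ≤ k * ∑ i, (e.repr x i) ^ 2 := by
    intro x
    have h1 : ‖x‖ ≤ ∑ i, |e.repr x i| := by
      conv_lhs => rw [← e.sum_repr x]
      refine norm_sum_le_of_le _ fun i _ => ?_
      rw [norm_smul, Real.norm_eq_abs]
      exact mul_le_of_le_one_right (abs_nonneg _) (he i)
    have h2 := sq_sum_le_card_mul_sum_sq (s := Finset.univ) (f := fun i => |e.repr x i|)
    simp only [sq_abs, Finset.card_univ, Fintype.card_fin] at h2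
    exact (pow_le_pow_left₀ (norm_nonneg x) h1 2).trans h2
  have hlow : ∀ x : X, ∑ i, (e.repr x i) ^ 2 ≤ k * ‖x‖ ^ 2 := by
    intro x
    calc ∑ i, (e.repr x i) ^ 2 ≤ ∑ _i : Fin k, ‖x‖ ^ 2 := by
          refine Finset.sum_le_sum fun i _ => ?_
          rw [← sq_abs]
          exact pow_le_pow_left₀ (abs_nonneg _) (hrepr x i) 2
      _ = k * ‖x‖ ^ 2 := by simp
  -- The walk commutes with linear functionals, so each coordinate obeys the scalar estimate.
  have hcoord : ∀ i, ∑ u, (e.repr ((lazyStep A)^[t] g u) i) ^ 2 ≤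
      (1 - 1 / (2 * γ)) ^ t * ∑ u, (e.repr (g u) i) ^ 2 := by
    intro i
    have h1 : ∑ u, e.coord i (g u) = 0 := by rw [← map_sum, hg, map_zero]
    have h2 := h.sum_sq_lazyStep_iterate_le h1 t
    rw [lazyStep_iterate_map] at h2
    exact h2
  calc ∑ u, ‖(lazyStep A)^[t] g u‖ ^ 2
      ≤ ∑ u, k * ∑ i, (e.repr ((lazyStep A)^[t] g u) i) ^ 2 :=
        Finset.sum_le_sum fun u _ => hup _
    _ = k * ∑ i, ∑ u, (e.repr ((lazyStep A)^[t] g u) i) ^ 2 := by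
        rw [← Finset.mul_sum, Finset.sum_comm]
    _ ≤ k * ∑ i, (1 - 1 / (2 * γ)) ^ t * ∑ u, (e.repr (g u) i) ^ 2 := by
        gcongr with i
        exact hcoord i
    _ = k * (1 - 1 / (2 * γ)) ^ t * ∑ u, ∑ i, (e.repr (g u) i) ^ 2 := by
        rw [← Finset.mul_sum, Finset.sum_comm, mul_assoc]
    _ ≤ k * (1 - 1 / (2 * γ)) ^ t * ∑ u, k * ‖g u‖ ^ 2 := by
        gcongr with u
        exact hlow _
    _ = _ := by rw [← Finset.mul_sum]; ring

end lazyStep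

/-! ### Moments of Lipschitz functions -/

section moments

variable {V X : Type*} [Fintype V] {A : Matrix V V ℝ} {γ : ℝ}

/-- The mean-square displacement of an `r`-Lipschitz function on a gapped walk is at most of order
`γ r log K`, where `K ≥ 2` bounds the dimension of the target. -/
theorem sum_norm_sq_le_of_gappedWalk [NormedAddCommGroup X] [NormedSpace ℝ X]
    [FiniteDimensional ℝ X] (h : IsGappedWalk A γ) {f : V → X} (hsum : ∑ u, f u = 0) {r K : ℝ}
    (hr : 0 ≤ r) (hf : ∀ u v, A u v ≠ 0 → ‖f u - f v‖ ≤ r) (hK : 2 ≤ K)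
    (hdim : (Module.finrank ℝ X : ℝ) ≤ K) :
    ∑ u, ‖f u‖ ^ 2 ≤ Fintype.card V * (32 * γ * Real.log K * r) ^ 2 := by
  have hγ := h.one_le
  have hlog : 1 / 2 ≤ Real.log K := by
    have := Real.log_two_gt_d9
    linarith [Real.log_le_log two_pos hK]
  have hγlog : 1 / 2 ≤ γ * Real.log K := by nlinarith
  -- This many steps bring the decay below `K⁻⁴`; after the loss `K ^ 2` there remains `K⁻² ≤ 1 /
  -- 4`.
  set t := ⌈8 * γ * Real.log K⌉₊
  have ht1 : 8 * γ * Real.log K ≤ t := Nat.le_ceil _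
  have ht2 : (t : ℝ) ≤ 16 * γ * Real.log K := by
    have := Nat.ceil_lt_add_one (a := 8 * γ * Real.log K) (by nlinarith)
    linarith
  have hdecay : (Module.finrank ℝ X : ℝ) ^ 2 * (1 - 1 / (2 * γ)) ^ t ≤ 1 / 4 := by
    have h1 : (1 - 1 / (2 * γ)) ^ t ≤ (K ^ 4)⁻¹ := by
      have h2 : 1 - 1 / (2 * γ) ≤ Real.exp (-(1 / (2 * γ))) := by
        linarith [Real.add_one_le_exp (-(1 / (2 * γ)))]
      have h3 : 0 ≤ 1 - 1 / (2 * γ) := by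
        rw [sub_nonneg, div_le_one (by linarith)]
        linarith
      refine (pow_le_pow_left₀ h3 h2 t).trans ?_
      have h4 : K ^ 4 = Real.exp (4 * Real.log K) := by
        rw [← Real.exp_log (show 0 < K by linarith), ← Real.exp_nat_mul, Real.log_exp]
        norm_num
      rw [← Real.exp_nat_mul, h4, ← Real.exp_neg, Real.exp_le_exp]
      have h5 : 4 * Real.log K ≤ t * (1 / (2 * γ)) := by
        rw [mul_one_div, le_div_iff₀ (by linarith)]
        linarith
      linarith
    have hk2 : (Module.finrank ℝ X : ℝ) ^ 2 ≤ K ^ 2 := pow_le_pow_left₀ (Nat.cast_nonneg _) hdim 2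
    calc (Module.finrank ℝ X : ℝ) ^ 2 * (1 - 1 / (2 * γ)) ^ t
        ≤ (Module.finrank ℝ X : ℝ) ^ 2 * (K ^ 4)⁻¹ := by gcongr
      _ ≤ K ^ 2 * (K ^ 4)⁻¹ := by gcongr
      _ = (K ^ 2)⁻¹ := by field_simp
      _ ≤ 1 / 4 := by
        rw [inv_le_comm₀ (by positivity) (by norm_num)]
        nlinarith
  have hT := sum_norm_sq_lazyStep_iterate_le h hsum t
  have hS : 0 ≤ ∑ u, ‖f u‖ ^ 2 := Finset.sum_nonneg fun _ _ => sq_nonneg _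
  -- With `S` the left side, this leads to `S ≤ 2 n (t r) ^ 2 + S / 2`, hence `S ≤ n (2 t r) ^ 2`.
  have hpt : ∑ u, ‖f u‖ ^ 2 ≤ ∑ u, (2 * (t * r) ^ 2 + 2 * ‖(lazyStep A)^[t] f u‖ ^ 2) := by
    refine Finset.sum_le_sum fun u _ => ?_
    have h1 := norm_sub_lazyStep_iterate_le h hr hf t u
    have h2 := norm_le_norm_sub_add (f u) ((lazyStep A)^[t] f u)
    have h3 := pow_le_pow_left₀ (norm_nonneg _) (h2.trans (add_le_add_left h1 _)) 2
    nlinarith [sq_nonneg (t * r - ‖(lazyStep A)^[t] f u‖)]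
  rw [Finset.sum_add_distrib, Finset.sum_const, Finset.card_univ, nsmul_eq_mul, ← Finset.mul_sum] at hpt
  have htr : (t * r) ^ 2 ≤ (16 * γ * Real.log K * r) ^ 2 := by gcongr
  have hn : (0 : ℝ) ≤ Fintype.card V := Nat.cast_nonneg _
  nlinarith [mul_le_mul_of_nonneg_left htr hn, mul_le_mul_of_nonneg_right hdecay hS]

/-- A form of Young's inequality, by splitting at `y = 2 a`. -/
theorem mul_pow_pred_le {a y : ℝ} (ha : 0 ≤ a) (hy : 0 ≤ y) {p : ℕ} (hp : p ≠ 0) :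
    a * y ^ (p - 1) ≤ 1 / 2 * y ^ p + (2 * a) ^ p := by
  obtain ⟨m, rfl⟩ := Nat.exists_eq_succ_of_ne_zero hp
  simp only [Nat.succ_eq_add_one, Nat.add_sub_cancel, pow_succ]
  have hym : 0 ≤ y ^ m := pow_nonneg hy m
  have ham : 0 ≤ (2 * a) ^ m := by positivity
  rcases le_total (2 * a) y with h | h
  · nlinarith [mul_le_mul_of_nonneg_left h hym, mul_nonneg ham ha]
  · nlinarith [mul_le_mul_of_nonneg_right (pow_le_pow_left₀ hy h m) ha, mul_nonneg hym hy,
      mul_nonneg ham ha]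

/-- Poincaré for `g ^ p`. As `g ≥ 1`, neighbouring values differ by at most a factor two, so `g ^ p`
varies by at most `p (2 g) ^ (p - 1)` along an edge; Young's inequality lets half of the left side
absorb the resulting energy. -/
theorem sum_pow_two_mul_le_of_gappedWalk [Nonempty V] (h : IsGappedWalk A γ) {g : V → ℝ}
    (hg : ∀ u, 1 ≤ g u) (hlip : ∀ u v, A u v ≠ 0 → |g u - g v| ≤ 1) {p : ℕ} (hp : p ≠ 0) :
    ∑ u, g u ^ (2 * p) ≤ 2 * ((∑ u, g u ^ p) ^ 2 / Fintype.card V) +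
      Fintype.card V * (2 * (γ * ((p : ℝ) ^ 2 * 4 ^ (p - 1))) ^ p) := by
  have hγ := h.one_le
  have h1 := h.poincare fun u => g u ^ p
  have h2 : ∑ u, ∑ v, A u v * (g u ^ p - g v ^ p) ^ 2 ≤
      ∑ u, (p : ℝ) ^ 2 * 4 ^ (p - 1) * (g u ^ 2) ^ (p - 1) := by
    rw [← h.sum_sum_mul_left fun u => (p : ℝ) ^ 2 * 4 ^ (p - 1) * (g u ^ 2) ^ (p - 1)]
    refine Finset.sum_le_sum fun u _ => Finset.sum_le_sum fun v _ => ?_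
    rcases eq_or_ne (A u v) 0 with h0 | h0
    · simp [h0]
    refine mul_le_mul_of_nonneg_left ?_ (h.nonneg u v)
    have h3 := hlip u v h0
    have h4 : max |g u| |g v| ≤ 2 * g u := by
      rw [abs_of_pos (by linarith [hg u]), abs_of_pos (by linarith [hg v])]
      exact max_le (by linarith [hg u]) (by linarith [(abs_le.1 h3).1, hg u])
    have h5 : |g u ^ p - g v ^ p| ≤ p * (2 * g u) ^ (p - 1) := by
      refine (abs_pow_sub_pow_le _ _ _).trans ?_
      have h6 : 0 ≤ max |g u| |g v| := le_max_of_le_left (abs_nonneg _)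
      calc |g u - g v| * p * max |g u| |g v| ^ (p - 1)
          ≤ 1 * p * (2 * g u) ^ (p - 1) := by gcongr
        _ = _ := by rw [one_mul]
    rw [← sq_abs]
    refine (pow_le_pow_left₀ (abs_nonneg _) h5 2).trans_eq ?_
    rw [mul_pow, ← pow_mul, mul_comm (p - 1) 2, pow_mul, mul_pow, mul_pow]
    norm_num
    ring
  have h3 : γ / 2 * ∑ u, (p : ℝ) ^ 2 * 4 ^ (p - 1) * (g u ^ 2) ^ (p - 1) ≤
      ∑ u, (1 / 2 * g u ^ (2 * p) + (γ * ((p : ℝ) ^ 2 * 4 ^ (p - 1))) ^ p) := by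
    rw [Finset.mul_sum]
    refine Finset.sum_le_sum fun u _ => ?_
    have h4 := mul_pow_pred_le (a := γ / 2 * ((p : ℝ) ^ 2 * 4 ^ (p - 1))) (by positivity)
      (sq_nonneg (g u)) hp
    rw [pow_mul]
    refine (le_of_eq (by ring)).trans (h4.trans_eq ?_)
    ring_nf
  rw [Finset.sum_add_distrib, ← Finset.mul_sum (a := (1 / 2 : ℝ)), Finset.sum_const,
    Finset.card_univ, nsmul_eq_mul] at h3
  have h4 := mul_le_mul_of_nonneg_left h2 (show 0 ≤ γ / 2 by linarith)
  have h5 : ∑ u, (g u ^ p) ^ 2 = ∑ u, g u ^ (2 * p) := by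
    simp only [← pow_mul, mul_comm p 2]
  rw [h5] at h1
  linarith

/-- Constants bounding the `2 ^ (j + 1)`-th moment in terms of the second moment. -/
noncomputable def momentConst : ℕ → ℝ
  | 0 => 1
  | j + 1 => 2 * momentConst j ^ 2 +
      2 * (((2 ^ (j + 1) : ℕ) : ℝ) ^ 2 * 4 ^ (2 ^ (j + 1) - 1)) ^ 2 ^ (j + 1)

theorem momentConst_nonneg (j : ℕ) : 0 ≤ momentConst j := by
  cases j with
  | zero => exact zero_le_one
  | succ j => rw [momentConst]; positivity

/-- Induction doubling the exponent; `γ ≤ R ^ 2` makes the error `γ ^ p` comparable to the main term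
`R ^ (2 p)`. -/
theorem sum_pow_le_of_gappedWalk [Nonempty V] (h : IsGappedWalk A γ) {g : V → ℝ}
    (hg : ∀ u, 1 ≤ g u) (hlip : ∀ u v, A u v ≠ 0 → |g u - g v| ≤ 1) {R : ℝ}
    (hγR : γ ≤ R ^ 2) (h2 : ∑ u, g u ^ 2 ≤ Fintype.card V * R ^ 2) (j : ℕ) :
    ∑ u, g u ^ 2 ^ (j + 1) ≤ Fintype.card V * (momentConst j * R ^ 2 ^ (j + 1)) := by
  have hn : (0 : ℝ) < Fintype.card V := by exact_mod_cast Fintype.card_pos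
  induction j with
  | zero => simpa [momentConst] using h2
  | succ j ih =>
    have h1 := sum_pow_two_mul_le_of_gappedWalk h hg hlip (p := 2 ^ (j + 1)) (by positivity)
    have hpow : 2 ^ (j + 1 + 1) = 2 * 2 ^ (j + 1) := by ring
    rw [hpow]
    refine h1.trans ?_
    rw [momentConst]
    generalize hp : 2 ^ (j + 1) = p at *
    generalize hc : (p : ℝ) ^ 2 * 4 ^ (p - 1) = c
    have hc0 : 0 ≤ c := hc ▸ by positivity
    have hγ := h.one_le
    have hs : 0 ≤ ∑ u, g u ^ p :=
      Finset.sum_nonneg fun u _ => pow_nonneg (by linarith [hg u]) _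
    have h3 : (∑ u, g u ^ p) ^ 2 / Fintype.card V ≤
        Fintype.card V * (momentConst j ^ 2 * R ^ (2 * p)) := by
      rw [div_le_iff₀ hn]
      refine (pow_le_pow_left₀ hs ih 2).trans_eq ?_
      rw [mul_comm 2 p, pow_mul]
      ring
    have h4 : (γ * c) ^ p ≤ c ^ p * R ^ (2 * p) := by
      rw [mul_pow, mul_comm, pow_mul]
      gcongr
    calc 2 * ((∑ u, g u ^ p) ^ 2 / Fintype.card V) + Fintype.card V * (2 * (γ * c) ^ p)
        ≤ 2 * (Fintype.card V * (momentConst j ^ 2 * R ^ (2 * p))) +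
          Fintype.card V * (2 * (c ^ p * R ^ (2 * p))) := by gcongr
      _ = _ := by ring

/-- The `q`-average displacement of an `r`-Lipschitz function on a gapped walk is at most of order
`γ r log K`, where `K ≥ 2` bounds the dimension of the target. -/
theorem sum_norm_sub_rpow_le_of_gappedWalk [NormedAddCommGroup X] [NormedSpace ℝ X]
    [FiniteDimensional ℝ X] [Nonempty V] (h : IsGappedWalk A γ) {f : V → X} {r K q : ℝ}
    (hr : 0 < r) (hf : ∀ u v, A u v ≠ 0 → ‖f u - f v‖ ≤ r) (hK : 2 ≤ K)
    (hdim : (Module.finrank ℝ X : ℝ) ≤ K) (hq : 0 ≤ q) {j : ℕ} (hj : q ≤ (2 ^ (j + 1) : ℕ)) :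
    ∑ u, ∑ v, ‖f u - f v‖ ^ q ≤ (Fintype.card V : ℝ) ^ 2 *
      ((1 + 2 ^ 2 ^ (j + 1) * momentConst j) * (r * (64 * γ * Real.log K)) ^ q) := by
  have hn : (0 : ℝ) < Fintype.card V := by exact_mod_cast Fintype.card_pos
  have hγ := h.one_le
  have hlog : 1 / 2 ≤ Real.log K := by
    have := Real.log_two_gt_d9
    linarith [Real.log_le_log two_pos hK]
  have hγlog : 1 / 2 ≤ γ * Real.log K := by nlinarith
  -- Twice the constant of the second-moment bound: it leaves room for the shift by one in `g`
  -- below.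
  set R := 64 * γ * Real.log K with hRdef
  have hR1 : 1 ≤ R := by linarith
  have hγR : γ ≤ R ^ 2 := by nlinarith
  set m : X := (Fintype.card V : ℝ)⁻¹ • ∑ u, f u with hm
  have hmean : ∑ u, (f u - m) = 0 := by
    rw [Finset.sum_sub_distrib, Finset.sum_const, Finset.card_univ, ← Nat.cast_smul_eq_nsmul ℝ, hm,
      smul_smul, mul_inv_cancel₀ hn.ne', one_smul, sub_self]
  have hL2 := sum_norm_sq_le_of_gappedWalk h hmean hr.le
    (fun u v huv => by simpa using hf u v huv) hK hdim
  set g : V → ℝ := fun u => ‖f u - m‖ / r + 1 with hgdef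
  have hg1 : ∀ u, 1 ≤ g u := fun u => by
    have : 0 ≤ ‖f u - m‖ / r := by positivity
    simp only [hgdef]
    linarith
  have hlip : ∀ u v, A u v ≠ 0 → |g u - g v| ≤ 1 := by
    intro u v huv
    have h1 : g u - g v = (‖f u - m‖ - ‖f v - m‖) / r := by simp only [hgdef]; ring
    rw [h1, abs_div, abs_of_pos hr, div_le_one hr]
    refine (abs_norm_sub_norm_le _ _).trans ?_
    simpa using hf u v huv
  have hg2 : ∑ u, g u ^ 2 ≤ Fintype.card V * R ^ 2 := by
    calc ∑ u, g u ^ 2 ≤ ∑ u, (2 / r ^ 2 * ‖f u - m‖ ^ 2 + 2) := by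
          refine Finset.sum_le_sum fun u _ => ?_
          have h1 : 2 / r ^ 2 * ‖f u - m‖ ^ 2 = 2 * (‖f u - m‖ / r) ^ 2 := by
            rw [div_pow]; ring
          rw [h1]
          simp only [hgdef]
          nlinarith [sq_nonneg (‖f u - m‖ / r - 1)]
      _ = 2 / r ^ 2 * ∑ u, ‖f u - m‖ ^ 2 + Fintype.card V * 2 := by
          rw [Finset.sum_add_distrib, ← Finset.mul_sum]; simp
      _ ≤ 2 / r ^ 2 * (Fintype.card V * (32 * γ * Real.log K * r) ^ 2) + Fintype.card V * 2 := by
          gcongr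
      _ = Fintype.card V * (R ^ 2 / 2 + 2) := by
          rw [hRdef]; field_simp; ring
      _ ≤ Fintype.card V * R ^ 2 := by
          gcongr
          nlinarith
  have hmom := sum_pow_le_of_gappedWalk h hg1 hlip hγR hg2 j
  have hN : 2 * (2 : ℝ) ^ (2 ^ (j + 1) - 1) = 2 ^ 2 ^ (j + 1) :=
    mul_pow_sub_one (by positivity) 2
  generalize 2 ^ (j + 1) = N at hmom hj hN ⊢
  have hR0 : 0 < R := by linarith
  have hrR : 0 < r * R := mul_pos hr hR0
  have hpt : ∀ u v, ‖f u - f v‖ ^ q ≤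
      (1 + 2 ^ (N - 1) / R ^ N * (g u ^ N + g v ^ N)) * (r * R) ^ q := by
    intro u v
    have h1 : ‖f u - f v‖ / (r * R) ≤ (g u + g v) / R := by
      have h2 : ‖f u - f v‖ ≤ r * (g u + g v) := by
        have h3 := norm_sub_le_norm_sub_add_norm_sub (f u) m (f v)
        rw [norm_sub_rev m] at h3
        have h4 : r * (g u + g v) = ‖f u - m‖ + ‖f v - m‖ + 2 * r := by
          simp only [hgdef]; field_simp; ring
        linarith
      rw [div_le_div_iff₀ hrR hR0]
      nlinarith [mul_le_mul_of_nonneg_right h2 hR0.le]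
    have h0 : 0 ≤ ‖f u - f v‖ / (r * R) := by positivity
    -- Real exponents reduce to the power of two `N ≥ q` through `x ^ q ≤ 1 + x ^ N`.
    have h2 : (‖f u - f v‖ / (r * R)) ^ q ≤ 1 + (‖f u - f v‖ / (r * R)) ^ N := by
      rcases le_total (‖f u - f v‖ / (r * R)) 1 with h3 | h3
      · linarith [Real.rpow_le_one h0 h3 hq, pow_nonneg h0 N]
      · have := Real.rpow_le_rpow_of_exponent_le h3 hj
        rw [Real.rpow_natCast] at this
        linarith
    have h3 : (‖f u - f v‖ / (r * R)) ^ N ≤ 2 ^ (N - 1) / R ^ N * (g u ^ N + g v ^ N) := by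
      refine (pow_le_pow_left₀ h0 h1 N).trans ?_
      rw [div_pow, div_mul_eq_mul_div]
      have := add_pow_le (zero_le_one.trans (hg1 u)) (zero_le_one.trans (hg1 v)) N
      gcongr
    rw [Real.div_rpow (norm_nonneg _) hrR.le, div_le_iff₀ (Real.rpow_pos_of_pos hrR q)] at h2
    refine h2.trans ?_
    gcongr
  calc ∑ u, ∑ v, ‖f u - f v‖ ^ q
      ≤ ∑ u, ∑ v, (1 + 2 ^ (N - 1) / R ^ N * (g u ^ N + g v ^ N)) * (r * R) ^ q :=
        Finset.sum_le_sum fun u _ => Finset.sum_le_sum fun v _ => hpt u v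
    _ = ((Fintype.card V : ℝ) ^ 2 +
          2 * 2 ^ (N - 1) / R ^ N * (Fintype.card V * ∑ u, g u ^ N)) * (r * R) ^ q := by
        simp only [← Finset.sum_mul, Finset.sum_add_distrib, ← Finset.mul_sum, Finset.sum_const,
          Finset.card_univ, nsmul_eq_mul]
        ring
    _ ≤ ((Fintype.card V : ℝ) ^ 2 + 2 * 2 ^ (N - 1) / R ^ N *
          (Fintype.card V * (Fintype.card V * (momentConst j * R ^ N)))) * (r * R) ^ q := by
        gcongr
    _ = _ := by
        rw [hN]
        field_simp

end moments

/-! ### Regular graphs: gap and typical distance -/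

section graphs

variable {V : Type*} [Fintype V] {G : SimpleGraph V} [DecidableRel G.Adj] {d : ℕ}

theorem one_lt_card_of_isRegularOfDegree [Nonempty V] (hd : 2 ≤ d) (hreg : G.IsRegularOfDegree d) :
    1 < Fintype.card V := by
  have v : V := Classical.arbitrary V
  have := G.degree_lt_card_verts v
  rw [hreg v] at this
  omega

variable [DecidableEq V]

theorem isGappedWalk_normalizedAdjMatrix [Nonempty V] (hd : 2 ≤ d) (hreg : G.IsRegularOfDegree d)
    {γ : ℝ} (hγ : 1 ≤ γ) (hgap : reciprocalSpectralGap G d ≤ ENNReal.ofReal γ) :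
    IsGappedWalk (normalizedAdjMatrix G d) γ := by
  have hrow : ∀ u, ∑ v, normalizedAdjMatrix G d u v = 1 := by
    intro u
    have h0 : (d : ℝ) ≠ 0 := by exact_mod_cast (by omega)
    simp only [normalizedAdjMatrix, Matrix.of_apply, ← Finset.sum_filter, Finset.sum_const,
      nsmul_eq_mul]
    rw [← SimpleGraph.neighborFinset_eq_filter, SimpleGraph.card_neighborFinset_eq_degree, hreg u,
      mul_one_div_cancel h0]
  have hA := normalizedAdjMatrix_isHermitian G d
  have hl : secondEigenvalue hA ≤ 1 - 1 / γ := by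
    have hγ0 : 0 < γ := by linarith
    -- Inverting first handles the truncation: if `λ₂ ≥ 1`, then `ofReal` gives `0`, which is below
    -- `γ⁻¹ > 0`.
    rw [reciprocalSpectralGap, ENNReal.inv_le_iff_inv_le, ← ENNReal.ofReal_inv_of_pos hγ0] at hgap
    by_contra! hcon
    have h1 : 1 - secondEigenvalue hA < γ⁻¹ := by rw [← one_div]; linarith
    exact absurd hgap (not_le.2 ((ENNReal.ofReal_lt_ofReal_iff (by positivity)).2 h1))
  have hγ1 : 0 < 1 / γ := by positivity
  refine ⟨fun u v => ?_, fun u v => ?_, hrow, hγ, fun g hg => ?_⟩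
  · simp only [normalizedAdjMatrix, Matrix.of_apply]
    split_ifs <;> positivity
  · simp [normalizedAdjMatrix, G.adj_comm]
  · have h1 : (normalizedAdjMatrix G d).mulVec 1 = 1 := by
      funext u
      simp [Matrix.mulVec, dotProduct, hrow]
    have h2 := dotProduct_mulVec_le_secondEigenvalue hA (one_lt_card_of_isRegularOfDegree hd hreg)
      (by linarith) h1 hg
    exact h2.trans (mul_le_mul_of_nonneg_right hl (Finset.sum_nonneg fun u _ => sq_nonneg _))

/-- In a connected graph of maximal degree `d`, at most half of the vertices lie at distance less
than `log n / (4 log d)` from a given vertex. -/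
theorem SimpleGraph.card_filter_dist_lt_le (hd : 2 ≤ d) (hdeg : ∀ v, G.degree v ≤ d)
    (hG : G.Connected) (hcard : 1 < Fintype.card V) (u : V) :
    ((Finset.univ.filter fun v =>
      (G.dist u v : ℝ) < Real.log (Fintype.card V) / (4 * Real.log d)).card : ℝ) ≤
      Fintype.card V / 2 := by
  set n := Fintype.card V
  have hn2 : (2 : ℝ) ≤ n := by exact_mod_cast hcard
  have hd2 : (2 : ℝ) ≤ d := by exact_mod_cast hd
  have hlogd : 0 < Real.log d := Real.log_pos (by linarith)
  set L := Real.log n / (4 * Real.log d)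
  have hL0 : 0 ≤ L := div_nonneg (Real.log_nonneg (by linarith)) (by linarith)
  rcases le_total L 1 with hL | hL
  · have h1 : (Finset.univ.filter fun v => (G.dist u v : ℝ) < L) ⊆ {u} := by
      intro v hv
      simp only [Finset.mem_filter, Finset.mem_univ, true_and, Finset.mem_singleton] at hv ⊢
      have h2 : G.dist u v < 1 := by exact_mod_cast hv.trans_le hL
      exact (hG.dist_eq_zero_iff.1 (by omega)).symm
    have h3 : ((Finset.univ.filter fun v => (G.dist u v : ℝ) < L).card : ℝ) ≤ 1 := by
      exact_mod_cast (Finset.card_le_card h1).trans_eq (Finset.card_singleton u)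
    linarith
  · have h1 : (Finset.univ.filter fun v => (G.dist u v : ℝ) < L) ⊆
        Finset.univ.filter fun v => G.dist u v ≤ ⌊L⌋₊ := by
      intro v hv
      simp only [Finset.mem_filter, Finset.mem_univ, true_and] at hv ⊢
      exact Nat.le_floor hv.le
    have h2 : ((Finset.univ.filter fun v => (G.dist u v : ℝ) < L).card : ℝ) ≤
        2 * (d : ℝ) ^ ⌊L⌋₊ := by
      have h3 := G.card_filter_dist_le hd hdeg hG u ⌊L⌋₊
      have h4 := Finset.card_le_card h1
      exact_mod_cast (show _ ≤ 2 * d ^ ⌊L⌋₊ by omega)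
    -- The ball has at most `2 y` points; `y ^ 4 ≤ n` and `y ≥ 2` give `2 y ≤ y ^ 4 / 2 ≤ n / 2`.
    set y : ℝ := (d : ℝ) ^ ⌊L⌋₊ with hy
    have hlogy : Real.log y ≤ L * Real.log d := by
      rw [hy, Real.log_pow]
      exact mul_le_mul_of_nonneg_right (Nat.floor_le hL0) hlogd.le
    have h5 : y ^ 4 ≤ n := by
      rw [← Real.log_le_log_iff (by positivity) (by linarith), Real.log_pow]
      have h6 : 4 * (L * Real.log d) = Real.log n := by simp only [L]; field_simp
      push_cast
      linarith
    have hy2 : 2 ≤ y := by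
      refine hd2.trans (le_self_pow₀ (by linarith) ?_)
      exact (Nat.floor_pos.2 hL).ne'
    have h6 : 4 * y ≤ y ^ 4 := by 
      have h7 : 2 ^ 3 ≤ y ^ 3 := pow_le_pow_left₀ zero_le_two hy2 3
      nlinarith
    linarith

/-- From each vertex, at least half of the vertices are at distance at least `log n / (4 log d)`. -/
theorem SimpleGraph.le_sum_dist_rpow (hd : 2 ≤ d) (hdeg : ∀ v, G.degree v ≤ d)
    (hG : G.Connected) (hcard : 1 < Fintype.card V) {q : ℝ} (hq : 0 ≤ q) :
    (Fintype.card V : ℝ) ^ 2 *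
      (1 / 2 * (Real.log (Fintype.card V) / (4 * Real.log d)) ^ q) ≤
      ∑ u, ∑ v, (G.dist u v : ℝ) ^ q := by
  have hball := SimpleGraph.card_filter_dist_lt_le hd hdeg hG hcard
  have hL0 : 0 ≤ Real.log (Fintype.card V) / (4 * Real.log d) := by
    have h1 := Real.log_natCast_nonneg (Fintype.card V)
    have h2 := Real.log_natCast_nonneg d
    positivity
  generalize Real.log (Fintype.card V) / (4 * Real.log d) = L at *
  have hu : ∀ u, Fintype.card V / 2 * L ^ q ≤ ∑ v, (G.dist u v : ℝ) ^ q := by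
    intro u
    have h1 := Finset.card_filter_add_card_filter_not (s := (Finset.univ : Finset V))
      (fun v => (G.dist u v : ℝ) < L)
    rw [Finset.card_univ] at h1
    have h2 : ((Finset.univ.filter fun v => (G.dist u v : ℝ) < L).card : ℝ) +
        ((Finset.univ.filter fun v => ¬ (G.dist u v : ℝ) < L).card : ℝ) = Fintype.card V := by
      exact_mod_cast h1
    calc Fintype.card V / 2 * L ^ q
        ≤ ((Finset.univ.filter fun v => ¬ (G.dist u v : ℝ) < L).card : ℝ) * L ^ q := by
          gcongr
          linarith [hball u]
      _ = ∑ v ∈ Finset.univ.filter fun v => ¬ (G.dist u v : ℝ) < L, L ^ q := by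
          rw [Finset.sum_const, nsmul_eq_mul]
      _ ≤ ∑ v ∈ Finset.univ.filter fun v => ¬ (G.dist u v : ℝ) < L, (G.dist u v : ℝ) ^ q := by
          refine Finset.sum_le_sum fun v hv => ?_
          have hv' := not_lt.1 (Finset.mem_filter.1 hv).2
          gcongr
      _ ≤ ∑ v, (G.dist u v : ℝ) ^ q :=
          Finset.sum_le_sum_of_subset_of_nonneg (Finset.filter_subset _ _)
            fun _ _ _ => by positivity
  calc (Fintype.card V : ℝ) ^ 2 * (1 / 2 * L ^ q) = ∑ _u : V, Fintype.card V / 2 * L ^ q := by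
        rw [Finset.sum_const, Finset.card_univ, nsmul_eq_mul]; ring
    _ ≤ _ := Finset.sum_le_sum fun u _ => hu u

end graphs

/-! ### Comparison of the two averages -/

theorem theorem14 (q : ℝ) (hq : 1 ≤ q) :
    ∃ c : ℝ, 0 < c ∧
      ∀ (γ D : ℝ), 1 ≤ γ → 1 ≤ D →
      ∀ (V : Type*) [Fintype V] [DecidableEq V] (G : SimpleGraph V) [DecidableRel G.Adj] (d : ℕ),
        2 ≤ d → G.IsRegularOfDegree d → G.Connected →
        reciprocalSpectralGap G d ≤ ENNReal.ofReal γ →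
      ∀ (X : Type*) [NormedAddCommGroup X] [NormedSpace ℝ X],
        EmbedsWithAverageDistortion (fun u v => (G.dist u v : ℝ)) X q D →
        FiniteDimensional ℝ X →
        (Fintype.card V : ℝ) ^ (c / (γ * D * Real.log d)) ≤
          max (Module.finrank ℝ X : ℝ) 2 := by
  obtain ⟨j, hj⟩ := pow_unbounded_of_one_lt q (one_lt_two (α := ℝ))
  have hqj : q ≤ (2 ^ (j + 1) : ℕ) := by
    push_cast
    refine hj.le.trans (pow_le_pow_right₀ one_le_two (Nat.le_succ j))
  set C := 1 + 2 ^ 2 ^ (j + 1) * momentConst j with hC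
  have hC1 : 1 ≤ C := by
    have := momentConst_nonneg j
    rw [hC, le_add_iff_nonneg_right]
    positivity
  -- `512 = 4 * 2 * 64`: from the typical distance, the half of the vertices, and the moment bound.
  refine ⟨1 / (512 * C), by positivity, ?_⟩
  rintro γ D hγ hD V _ _ G _ d hd hreg hG hgap X _ _ ⟨σ, f, hσ, hlip, havg⟩ hX
  have : Nonempty V := hG.nonempty
  have hcard := one_lt_card_of_isRegularOfDegree hd hreg
  have hn : (1 : ℝ) < Fintype.card V := by exact_mod_cast hcard
  have hd2 : (2 : ℝ) ≤ d := by exact_mod_cast hd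
  have hlogd : 0 < Real.log d := Real.log_pos (by linarith)
  set K := max (Module.finrank ℝ X : ℝ) 2
  have hK : 2 ≤ K := le_max_right _ _
  have hlogK : 0 < Real.log K := Real.log_pos (by linarith)
  have hedge : ∀ u v, normalizedAdjMatrix G d u v ≠ 0 → ‖f u - f v‖ ≤ σ * D := by
    intro u v huv
    have hadj : G.Adj u v := by
      by_contra hcon
      exact huv (by simp [normalizedAdjMatrix, hcon])
    have h1 : dist (f u) (f v) ≤ σ * D * (G.dist u v : ℝ) := hlip u v
    rwa [SimpleGraph.dist_eq_one_iff_adj.2 hadj, Nat.cast_one, mul_one, dist_eq_norm] at h1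
  have hup := sum_norm_sub_rpow_le_of_gappedWalk
    (isGappedWalk_normalizedAdjMatrix hd hreg hγ hgap) (by positivity) hedge hK (le_max_left _ _)
    (zero_le_one.trans hq) hqj
  have hlow := SimpleGraph.le_sum_dist_rpow hd (fun v => (hreg v).le) hG hcard
    (zero_le_one.trans hq)
  rw [← hC] at hup
  set L := Real.log (Fintype.card V) / (4 * Real.log d) with hL
  have hL0 : 0 ≤ L := div_nonneg (Real.log_nonneg hn.le) (by positivity)
  set R := 64 * γ * Real.log K with hR
  have hn2 : (0 : ℝ) < (Fintype.card V : ℝ) ^ 2 := by positivity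
  have hmain : σ ^ q * (1 / 2 * L ^ q) ≤ C * (σ * D * R) ^ q := by
    have h1 : 1 / 2 * L ^ q ≤
        1 / (Fintype.card V : ℝ) ^ 2 * ∑ u, ∑ v, (G.dist u v : ℝ) ^ q := by
      rwa [one_div_mul_eq_div _ (∑ u, _), le_div_iff₀ hn2, mul_comm]
    have h2 : 1 / (Fintype.card V : ℝ) ^ 2 * ∑ u, ∑ v, dist (f u) (f v) ^ q ≤
        C * (σ * D * R) ^ q := by
      simp only [dist_eq_norm]
      rwa [one_div_mul_eq_div, div_le_iff₀ hn2, mul_comm]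
    exact (mul_le_mul_of_nonneg_left h1 (by positivity)).trans (havg.trans h2)
  have hLR : L ≤ 2 * C * (D * R) := by
    rw [mul_assoc σ, Real.mul_rpow hσ.le (by positivity), mul_left_comm C] at hmain
    have h1 := le_of_mul_le_mul_left hmain (Real.rpow_pos_of_pos hσ q)
    -- Here `q ≥ 1` lets the constant move inside the `q`-th power.
    have h2 : 2 * C ≤ (2 * C) ^ q := Real.self_le_rpow_of_one_le (by linarith) hq
    have h3 : L ^ q ≤ (2 * C * (D * R)) ^ q := by
      rw [Real.mul_rpow (by positivity) (by positivity)]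
      calc L ^ q ≤ 2 * C * (D * R) ^ q := by linarith
        _ ≤ _ := by gcongr
    exact (Real.rpow_le_rpow_iff hL0 (by positivity) (by linarith)).1 h3
  have hlog : Real.log (Fintype.card V) * (1 / (512 * C) / (γ * D * Real.log d)) ≤ Real.log K := by
    rw [hL, div_le_iff₀ (by positivity), hR] at hLR
    rw [div_div, mul_one_div, div_le_iff₀ (by positivity)]
    linarith
  rw [Real.rpow_def_of_pos (by linarith)]
  exact (Real.exp_le_exp.2 hlog).trans_eq (Real.exp_log (by linarith))
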